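/- Let $\Omega\subset\mathbb C^n$ be a bounded domain (open, connected, non-empty), and let $A(\Omega)$ be the completion, in the supremum norm over $\overline\Omega$, of the algebra of functions holomorphic in some neighbourhood of $\overline\Omega$. A contractive Hilbert module over $A(\Omega)$ is a complex Hilbert space $\mathcal R$ that is a unital $A(\Omega)$-module with $\|\varphi h\|\le\|\varphi\|\,\|h\|$. For $z\in\Omega$ let $\mathcal R_z$ be the closure of $A(\Omega)_z\mathcal R$, where $A(\Omega)_z=\{\varphi\in A(\Omega):\varphi(z)=0\}$; the localization $\mathcal R\otimes_{A}\mathbb C_z$ is the quotient Hilbert space $\mathcal R/\mathcal R_z$, and $h\otimes_A 1_z$ denotes the class of $h$. Let $m$ be finite. The contractive Hilbert module $\mathcal R$ is quasi-free of rank $m$ for the generating set $\{f_1,\dots,f_m\}\subset\mathcal R$ if (i) the linear span of $\{\varphi f_i:\varphi\in A(\Omega),\,1\le i\le m\}$ is dense in $\mathcal R$; (ii) for every $z\in\Omega$ the vectors $f_1\otimes_A1_z,\dots,f_m\otimes_A1_z$ form a basis of $\mathcal R\otimes_A\mathbb C_z$; (iii) the evaluations are locally uniformly bounded: every point of $\Omega$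 has a neighbourhood $V\subset\Omega$ and a constant $C$ with $\|(\varphi_1(w),\dots,\varphi_m(w))\|_{\ell^2_m}\le C\,\|\sum_i\varphi_if_i\|_{\mathcal R}$ for all $w\in V$ and all $\varphi_1,\dots,\varphi_m\in A(\Omega)$; (iv) for every sequence $(\varphi^{(k)}_1,\dots,\varphi^{(k)}_m)$ in $A(\Omega)^m$ such that $\sum_i\varphi^{(k)}_if_i$ is Cauchy in $\mathcal R$, one has $(\varphi_1^{(k)}(z),\dots,\varphi_m^{(k)}(z))\to0$ for all $z\in\Omega$ if and only if $\|\sum_i\varphi^{(k)}_if_i\|_{\mathcal R}\to0$. Let $\mathcal R$ and $\mathcal R'$ be contractive Hilbert modules over $A(\Omega)$ that are quasi-free of the same finite rank $m$ for the generating sets $\{f_i\}_{i=1}^m$ and $\{f'_i\}_{i=1}^m$, respectively. Let $\Delta\subset\mathcal R\oplus\mathcal R'$ be the closed linear span of $\{\varphi f_i\oplus\varphi f'_i:\varphi\in A(\Omega),\,1\le i\le m\}$, and let $\delta(\mathcal R,\mathcal R')$ be the linear transformation from $\mathcal R$ to $\mathcal R'$ with graph $\Delta$. Suppose that $$\langle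 f_i\otimes_A1_z,\;f_j\otimes_A1_z\rangle_{\mathcal R\otimes_A\mathbb C_z}=\langle f'_i\otimes_A1_z,\;f'_j\otimes_A1_z\rangle_{\mathcal R'\otimes_A\mathbb C_z}\qquad\text{for all }z\in\Omega,\ 1\le i,j\le m.$$ Then $\Delta$ is the graph of a transformation (so that $\delta(\mathcal R,\mathcal R')$ is well defined), $\delta(\mathcal R,\mathcal R')$ is an isometric module map defined on all of $\mathcal R$, and $\mathcal R$ and $\mathcal R'$ are unitarily equivalent, i.e. there is a unitary module map from $\mathcal R$ onto $\mathcal R'$. -/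

import Mathlib

open Filter Topology
open scoped BoundedContinuousFunction InnerProductSpace

noncomputable section

namespace QuasiFree

/-- The restrictions to `closure Ω` of functions holomorphic in some neighbourhood of `closure Ω`
(bounded on `closure Ω`, which is automatic when `Ω` is bounded). -/
def holomorphicNearClosure {n : ℕ} (Ω : Set (EuclideanSpace ℂ (Fin n))) :
    Subalgebra ℂ (closure Ω →ᵇ ℂ) where
  carrier := {φ | ∃ (U : Set (EuclideanSpace ℂ (Fin n))) (g : EuclideanSpace ℂ (Fin n) → ℂ),
    IsOpen U ∧ closure Ω ⊆ U ∧ DifferentiableOn ℂ g U ∧ ∀ x : closure Ω, φ x = g x}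
  mul_mem' := by
    rintro φ ψ ⟨U, g, hU, hUΩ, hg, hφ⟩ ⟨V, h, hV, hVΩ, hh, hψ⟩
    exact ⟨U ∩ V, fun x => g x * h x, hU.inter hV, Set.subset_inter hUΩ hVΩ,
      (hg.mono Set.inter_subset_left).mul (hh.mono Set.inter_subset_right),
      fun x => by simp [hφ, hψ]⟩
  add_mem' := by
    rintro φ ψ ⟨U, g, hU, hUΩ, hg, hφ⟩ ⟨V, h, hV, hVΩ, hh, hψ⟩
    exact ⟨U ∩ V, fun x => g x + h x, hU.inter hV, Set.subset_inter hUΩ hVΩ,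
      (hg.mono Set.inter_subset_left).add (hh.mono Set.inter_subset_right),
      fun x => by simp [hφ, hψ]⟩
  algebraMap_mem' := fun c =>
    ⟨Set.univ, fun _ => c, isOpen_univ, Set.subset_univ _, differentiableOn_const c,
      fun _ => rfl⟩

/-- The function algebra `A(Ω)`: the completion, in the supremum norm over `closure Ω`, of the
algebra of functions holomorphic in a neighbourhood of `closure Ω`. -/
abbrev FunctionAlgebra {n : ℕ} (Ω : Set (EuclideanSpace ℂ (Fin n))) :
    Subalgebra ℂ (closure Ω →ᵇ ℂ) :=
  (holomorphicNearClosure Ω).topologicalClosure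

/-- The value `φ(z)` of `φ ∈ A(Ω)` at a point `z ∈ Ω`. -/
def value {n : ℕ} {Ω : Set (EuclideanSpace ℂ (Fin n))} (φ : FunctionAlgebra Ω) (z : Ω) : ℂ :=
  (φ : closure Ω →ᵇ ℂ) ⟨z, subset_closure z.2⟩

section Modules

/- In this section `R` and `R'` are contractive Hilbert modules over `A(Ω)`: complex Hilbert spaces
that are unital `A(Ω)`-modules (compatibly with the complex scalars) with
`‖φ • h‖ ≤ ‖φ‖ * ‖h‖`, the latter being what `IsBoundedSMul` says. -/
variable {n : ℕ} (Ω : Set (EuclideanSpace ℂ (Fin n)))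
  {R : Type*} [NormedAddCommGroup R] [InnerProductSpace ℂ R] [CompleteSpace R]
  [Module (FunctionAlgebra Ω) R] [IsScalarTower ℂ (FunctionAlgebra Ω) R]
  [IsBoundedSMul (FunctionAlgebra Ω) R]
  {R' : Type*} [NormedAddCommGroup R'] [InnerProductSpace ℂ R'] [CompleteSpace R']
  [Module (FunctionAlgebra Ω) R'] [IsScalarTower ℂ (FunctionAlgebra Ω) R']
  [IsBoundedSMul (FunctionAlgebra Ω) R']

variable {Ω} in
/-- `R_z`: the closure of `A(Ω)_z R`, where `A(Ω)_z` is the ideal of functions vanishing at `z`. -/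
abbrev vanishingSubmodule (R : Type*) [NormedAddCommGroup R] [InnerProductSpace ℂ R]
    [Module (FunctionAlgebra Ω) R] (z : Ω) : Submodule ℂ R :=
  (Submodule.span ℂ
    {x : R | ∃ (φ : FunctionAlgebra Ω) (h : R), value φ z = 0 ∧ x = φ • h}).topologicalClosure

variable {Ω} in
/-- The localization `R ⊗_{A(Ω)} ℂ_z`, as the quotient Hilbert space `R / R_z`
(with Mathlib's quotient norm and the inner product inducing it). -/
abbrev Localization (R : Type*) [NormedAddCommGroup R] [InnerProductSpace ℂ R]
    [Module (FunctionAlgebra Ω) R] (z : Ω) : Type _ :=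
  R ⧸ vanishingSubmodule R z

variable {Ω} in
/-- The localized vector `h ⊗ 1_z`. -/
def localize (h : R) (z : Ω) : Localization R z :=
  Submodule.Quotient.mk h

variable {Ω} in
/-- The element `∑ φ_i f_i` of `R` attached to a tuple `(φ_i)`, i.e. to `∑ φ_i ⊗ e_i` in
`A(Ω) ⊗ ℓ²_m`. -/
def combination {m : ℕ} (f : Fin m → R) (φ : Fin m → FunctionAlgebra Ω) : R :=
  ∑ i, φ i • f i

variable {Ω} in
/-- Evaluation at `z` on `A(Ω) ⊗ ℓ²_m`. -/
def evalAt {m : ℕ} (z : Ω) (φ : Fin m → FunctionAlgebra Ω) : EuclideanSpace ℂ (Fin m) :=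
  WithLp.toLp 2 (fun i => value (φ i) z)

/-- The contractive Hilbert module `R` over `A(Ω)` is quasi-free of rank `m` relative to the
generating set `f_1, …, f_m`. -/
structure IsQuasiFree {m : ℕ} (f : Fin m → R) : Prop where
  /-- the set generates `R` -/
  generates : Dense (Submodule.span (FunctionAlgebra Ω) (Set.range f) : Set R)
  /-- the localized vectors are linearly independent … -/
  linearIndependent : ∀ z : Ω, LinearIndependent ℂ (fun i => localize (f i) z)
  /-- … and span the localization: they form a basis of it -/
  span_eq_top : ∀ z : Ω, Submodule.span ℂ (Set.range (fun i => localize (f i) z)) = ⊤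
  /-- the evaluations are bounded, locally uniformly on `Ω` -/
  eval_locally_bounded : ∀ z : Ω, ∃ C : ℝ, ∀ᶠ w in 𝓝 z,
    ∀ φ : Fin m → FunctionAlgebra Ω, ‖evalAt w φ‖ ≤ C * ‖combination f φ‖
  /-- a norm-Cauchy sequence tends to zero in norm iff it tends to zero pointwise on `Ω` -/
  tendsto_zero_iff : ∀ F : ℕ → Fin m → FunctionAlgebra Ω,
    CauchySeq (fun k => combination f (F k)) →
      ((∀ z : Ω, Tendsto (fun k => evalAt z (F k)) atTop (𝓝 0)) ↔
        Tendsto (fun k => combination f (F k)) atTop (𝓝 0))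

/-- The subspace `Δ` of `R ⊕ R'`: the closed linear span of the vectors `φ f_i ⊕ φ f'_i`. -/
def deltaGraph {m : ℕ} (f : Fin m → R) (f' : Fin m → R') : Submodule ℂ (R × R') :=
  (Submodule.span ℂ
    {p : R × R' | ∃ (φ : FunctionAlgebra Ω) (i : Fin m),
      p = (φ • f i, φ • f' i)}).topologicalClosure

/-- The (a priori unbounded) transformation `δ(R, R')` with graph `Δ`. -/
def delta {m : ℕ} (f : Fin m → R) (f' : Fin m → R') : R →ₗ.[ℂ] R' :=
  (deltaGraph Ω f f').toLinearPMap

/-- The partially defined linear map `T` is defined on all of `R`, is isometric, and commutes with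
the action of `A(Ω)`. -/
structure IsIsometricModuleMap (T : R →ₗ.[ℂ] R') : Prop where
  domain_eq_top : T.domain = ⊤
  norm_map : ∀ x : T.domain, ‖T x‖ = ‖(x : R)‖
  map_smul : ∀ (φ : FunctionAlgebra Ω) (x : T.domain),
    ∃ h : φ • (x : R) ∈ T.domain, T ⟨φ • (x : R), h⟩ = φ • T x

/-- `R` and `R'` are unitarily equivalent: there is a unitary module map from `R` onto `R'`. -/
def UnitarilyEquivalent (R R' : Type*)
    [NormedAddCommGroup R] [InnerProductSpace ℂ R] [Module (FunctionAlgebra Ω) R]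
    [NormedAddCommGroup R'] [InnerProductSpace ℂ R'] [Module (FunctionAlgebra Ω) R'] : Prop :=
  ∃ U : R ≃ₗᵢ[ℂ] R', ∀ (φ : FunctionAlgebra Ω) (h : R), U (φ • h) = φ • U h

end Modules

end QuasiFree

end

noncomputable section

namespace QuasiFree

/-! ### Holomorphic families of operators, polarization, identity theorem. -/

open Metric Set ContinuousLinearMap

/-! By (i) and (iii), evaluation of tuples at z extends to a bounded operator e_z : R → ℓ²_m; by
(iv) the e_z jointly separate points, so R is a reproducing kernel space with kernel K(w,z) = e_w
e_z†. By (ii), ker e_z = R_z (`ker_evaluation`), so the representatives of f_i ⊗ 1_z orthogonal to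
R_z give a section of e_z, and its Gram operator is the inverse of e_z e_z†. Equal Gram matrices
therefore mean that the kernels of R and R' agree on the diagonal (`comp_adjoint_eq_of_gram`).

K is holomorphic in w and antiholomorphic in z. Polarization near the diagonal and the identity
theorem on the connected set Ω make the kernels agree everywhere (`comp_adjoint_eq_of_diagonal`);
holomorphy along complex lines suffices. Then e_z†v ↦ e'_z†v extends to a unitary
(`exists_unitary_of_kernel_eq`). It intertwines evaluations, hence the module actions, and sends f_i
to f'_i, so its graph is Δ. -/

/-- A locally bounded, pointwise holomorphic family of operators is holomorphic in norm. -/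
theorem differentiableOn_of_forall_apply {X F : Type*} [NormedAddCommGroup X] [NormedSpace ℂ X]
    [NormedAddCommGroup F] [NormedSpace ℂ F] [CompleteSpace F] {e : ℂ → X →L[ℂ] F} {U : Set ℂ}
    (hU : IsOpen U) (he : ∀ x, DifferentiableOn ℂ (fun s => e s x) U)
    (hb : ∀ s ∈ U, ∃ C, ∀ᶠ t in 𝓝 s, ‖e t‖ ≤ C) : DifferentiableOn ℂ e U := by
  intro c hc
  obtain ⟨C, hC⟩ := hb c hc
  obtain ⟨r, hr, hball⟩ := Metric.eventually_nhds_iff_ball.1 (hC.and (hU.mem_nhds hc))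
  have hC0 : 0 ≤ C := (norm_nonneg _).trans (hball c (mem_ball_self hr)).1
  -- Cauchy's estimate on circles of radius r/4, which stay inside the ball of radius r. The bound
  -- is linear in ‖x‖, so it gives Lipschitz continuity in operator norm.
  have hlip : ∀ x, ∀ s ∈ ball c (r / 2), ∀ t ∈ ball c (r / 2),
      ‖e t x - e s x‖ ≤ C * ‖x‖ / (r / 4) * ‖t - s‖ := by
    intro x s hs t ht
    refine (convex_ball c (r / 2)).norm_image_sub_le_of_norm_deriv_le (f := fun s => e s x)
      (fun u hu => ?_) (fun u hu => ?_) hs ht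
    · exact (he x).differentiableAt
        (hU.mem_nhds (hball u (ball_subset_ball (by linarith) hu)).2)
    · have hsub : closedBall u (r / 4) ⊆ ball c r := by
        intro v hv
        rw [mem_closedBall] at hv
        rw [mem_ball] at hu ⊢
        linarith [dist_triangle v u c]
      refine Complex.norm_deriv_le_of_forall_mem_sphere_norm_le (by positivity)
        (((he x).mono fun v hv => (hball v (hsub hv)).2).diffContOnCl_ball subset_rfl)
        fun v hv => (e v).le_of_opNorm_le (hball v (hsub (sphere_subset_closedBall hv))).1 x
  have hcont : ContinuousOn e (ball c (r / 2)) := by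
    have : LipschitzOnWith (Real.toNNReal (C / (r / 4))) e (ball c (r / 2)) := by
      refine LipschitzOnWith.of_dist_le_mul fun t ht s hs => ?_
      rw [Real.coe_toNNReal _ (by positivity), dist_eq_norm, dist_eq_norm]
      refine opNorm_le_bound _ (by positivity) fun x => ?_
      refine (hlip x s hs t ht).trans_eq ?_
      ring
    exact this.continuousOn
  have hsub : closedBall c (r / 4) ⊆ ball c (r / 2) := closedBall_subset_ball (by linarith)
  have hci : CircleIntegrable e c (r / 4) :=
    (hcont.mono (sphere_subset_closedBall.trans hsub)).circleIntegrable (by positivity)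
  -- Norm continuity makes the operator-valued Cauchy integral meaningful; the formula is then
  -- checked on each vector x. Such an integral is analytic in s.
  have hcauchy : ∀ s ∈ ball c (r / 4),
      (2 * Real.pi * Complex.I : ℂ)⁻¹ • (∮ z in C(c, r / 4), (z - s)⁻¹ • e z) = e s := by
    intro s hs
    have hsc : ContinuousOn (fun z => (z - s)⁻¹ • e z) (sphere c (r / 4)) := by
      refine ContinuousOn.smul (ContinuousOn.inv₀ (f := fun z => z - s) (by fun_prop) fun z hz => ?_)
        (hcont.mono (sphere_subset_closedBall.trans hsub))
      rintro h0
      rw [sub_eq_zero] at h0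
      subst h0
      exact (mem_ball.1 hs).ne (mem_sphere.1 hz)
    ext x
    have hx : DiffContOnCl ℂ (fun s => e s x) (ball c (r / 4)) :=
      ((he x).mono fun v hv => (hball v
        (ball_subset_ball (by linarith) (hsub hv))).2).diffContOnCl_ball subset_rfl
    rw [← hx.two_pi_i_inv_smul_circleIntegral_sub_inv_smul hs, smul_apply]
    congr 1
    have := (apply ℂ F x).intervalIntegral_comp_comm
      (hsc.circleIntegrable (by positivity)).out
    simpa [circleIntegral] using this.symm
  have hd : DifferentiableAt ℂ
      (fun s => (2 * Real.pi * Complex.I : ℂ)⁻¹ • ∮ z in C(c, r / 4), (z - s)⁻¹ • e z) c := by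
    have hr4 : 0 < r / 4 := by positivity
    lift r / 4 to NNReal using hr4.le with ρ
    exact (hasFPowerSeriesOn_cauchy_integral hci (by exact_mod_cast hr4)).analyticAt.differentiableAt
  refine (hd.congr_of_eventuallyEq ?_).differentiableWithinAt
  filter_upwards [ball_mem_nhds c (show 0 < r / 4 by positivity)] with s hs using (hcauchy s hs).symm

/-- Polarization: a holomorphic function of two variables on a bidisc vanishes
if it vanishes on the conjugate diagonal. -/
theorem eq_zero_of_conj_diagonal {G : Type*} [NormedAddCommGroup G] [NormedSpace ℂ G]
    [CompleteSpace G] {H : ℂ × ℂ → G} {ρ : ℝ}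
    (hH : DifferentiableOn ℂ H (ball 0 ρ ×ˢ ball 0 ρ))
    (h0 : ∀ s ∈ ball (0 : ℂ) ρ, H (s, starRingEnd ℂ s) = 0) :
    ∀ s ∈ ball (0 : ℂ) ρ, ∀ t ∈ ball (0 : ℂ) ρ, H (s, t) = 0 := by
  have key : ∀ (ℓ : ℂ →L[ℂ] ℂ × ℂ) (p : ℂ × ℂ), p ∈ ball (0 : ℂ) ρ ×ˢ ball (0 : ℂ) ρ →
      (∀ᶠ x : ℝ in 𝓝 0, H (p + ℓ x) = 0) →
      ∀ x, p + ℓ x ∈ ball (0 : ℂ) ρ ×ˢ ball (0 : ℂ) ρ → H (p + ℓ x) = 0 := by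
    intro ℓ p hp hreal x hx
    set V : Set ℂ := (fun x => p + ℓ x) ⁻¹' (ball (0 : ℂ) ρ ×ˢ ball (0 : ℂ) ρ)
    have hVo : IsOpen V := (isOpen_ball.prod isOpen_ball).preimage (by fun_prop)
    have hVc : Convex ℝ V := by
      have h1 : Convex ℝ ((fun q => p + q) ⁻¹' (ball (0 : ℂ) ρ ×ˢ ball (0 : ℂ) ρ)) :=
        ((convex_ball _ _).prod (convex_ball _ _)).translate_preimage_right p
      exact h1.linear_preimage (ℓ.restrictScalars ℝ).toLinearMap
    have han : AnalyticOnNhd ℂ (fun x => H (p + ℓ x)) V :=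
      (hH.comp (f := fun x => p + ℓ x) (by fun_prop) fun x hx => hx).analyticOnNhd hVo
    refine han.eqOn_zero_of_preconnected_of_frequently_eq_zero hVc.isPreconnected
      (z₀ := 0) (by simpa [V] using hp) ?_ hx
    have ht : Tendsto (fun x : ℝ => (x : ℂ)) (𝓝[≠] 0) (𝓝[≠] 0) := by
      refine tendsto_nhdsWithin_iff.2 ⟨?_, ?_⟩
      · exact (Complex.continuous_ofReal.tendsto' 0 0 (by simp)).mono_left nhdsWithin_le_nhds
      · filter_upwards [self_mem_nhdsWithin] with x hx
        simpa using hx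
    exact ht.frequently (hreal.filter_mono nhdsWithin_le_nhds).frequently
  have hρ : ∀ z : ℂ, z ∈ ball (0 : ℂ) ρ → starRingEnd ℂ z ∈ ball (0 : ℂ) ρ := by simp
  -- Coordinates (s, t) = (x + iy, x - iy): the conjugate diagonal is the set where x and y are
  -- real.
  let ℓ₁ : ℂ →L[ℂ] ℂ × ℂ := (ContinuousLinearMap.id ℂ ℂ).prod (ContinuousLinearMap.id ℂ ℂ)
  let ℓ₂ : ℂ →L[ℂ] ℂ × ℂ :=
    (Complex.I • ContinuousLinearMap.id ℂ ℂ).prod (-(Complex.I • ContinuousLinearMap.id ℂ ℂ))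
  have hmem : ∀ (ℓ : ℂ →L[ℂ] ℂ × ℂ) (p : ℂ × ℂ), p ∈ ball (0 : ℂ) ρ ×ˢ ball (0 : ℂ) ρ →
      ∀ᶠ x : ℝ in 𝓝 0, p + ℓ x ∈ ball (0 : ℂ) ρ ×ˢ ball (0 : ℂ) ρ := by
    intro ℓ p hp
    have : Continuous fun x : ℝ => p + ℓ x := by fun_prop
    exact (this.tendsto' 0 p (by simp)).eventually ((isOpen_ball.prod isOpen_ball).mem_nhds hp)
  intro s hs t ht
  have hρ0 : 0 < ρ := pos_of_mem_ball hs
  have hadd : ∀ z ∈ ball (0 : ℂ) ρ, ∀ w ∈ ball (0 : ℂ) ρ, (z + w) / 2 ∈ ball (0 : ℂ) ρ := by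
    intro z hz w hw
    simp only [mem_ball_zero_iff, norm_div, Complex.norm_ofNat] at *
    linarith [norm_add_le z w]
  -- first complexify the real coordinate, then the imaginary one
  have h1 : ∀ y : ℝ, ∀ x : ℂ,
      ℓ₂ y ∈ ball (0 : ℂ) ρ ×ˢ ball (0 : ℂ) ρ →
      ℓ₂ y + ℓ₁ x ∈ ball (0 : ℂ) ρ ×ˢ ball (0 : ℂ) ρ → H (ℓ₂ y + ℓ₁ x) = 0 := by
    intro y x hy hx
    refine key ℓ₁ (ℓ₂ y) hy ?_ x hx
    filter_upwards [hmem ℓ₁ (ℓ₂ y) hy] with u hu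
    have := h0 (Complex.I * y + u) (by simpa [ℓ₁, ℓ₂] using hu.1)
    simpa [ℓ₁, ℓ₂] using this
  have hx0 : ℓ₁ ((s + t) / 2) ∈ ball (0 : ℂ) ρ ×ˢ ball (0 : ℂ) ρ :=
    ⟨hadd s hs t ht, hadd s hs t ht⟩
  have h2 := key ℓ₂ (ℓ₁ ((s + t) / 2)) hx0 (by
    filter_upwards [hmem ℓ₂ _ hx0, hmem ℓ₂ 0 (by simp [hρ0])] with y hy hy0
    rw [add_comm] at hy ⊢
    exact h1 y _ (by simpa using hy0) hy) ((s - t) / (2 * Complex.I))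
  have hs' : (s + t) / 2 + Complex.I * ((s - t) / (2 * Complex.I)) = s := by
    field_simp; ring
  have ht' : (s + t) / 2 + -(Complex.I * ((s - t) / (2 * Complex.I))) = t := by
    field_simp; ring
  have hst : ℓ₁ ((s + t) / 2) + ℓ₂ ((s - t) / (2 * Complex.I)) = (s, t) := by
    refine Prod.ext ?_ ?_
    · simpa [ℓ₁, ℓ₂] using hs'
    · simpa [ℓ₁, ℓ₂] using ht'
  rw [hst] at h2
  exact h2 ⟨hs, ht⟩

/-- `g` is holomorphic on `Ω` along every complex line. -/
def HolomorphicOnLines {E G : Type*} [NormedAddCommGroup E] [NormedSpace ℂ E]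
    [NormedAddCommGroup G] [NormedSpace ℂ G] (g : E → G) (Ω : Set E) : Prop :=
  ∀ a d : E, DifferentiableOn ℂ (fun s : ℂ => g (a + s • d)) {s | a + s • d ∈ Ω}

/-- The identity theorem on a domain, for functions holomorphic along every complex line. -/
theorem HolomorphicOnLines.eqOn_zero {E G : Type*} [NormedAddCommGroup E] [NormedSpace ℂ E]
    [NormedAddCommGroup G] [NormedSpace ℂ G] [CompleteSpace G] {Ω : Set E} (hΩ : IsOpen Ω)
    (hc : IsPreconnected Ω) {g : E → G}
    (hg : HolomorphicOnLines g Ω)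
    {z : E} (hz : z ∈ Ω) (h0 : ∀ᶠ w in 𝓝 z, g w = 0) : ∀ w ∈ Ω, g w = 0 := by
  -- The open set of points near which g vanishes is also closed in Ω: from such a v close to w, a
  -- complex line reaches every p in a ball around w.
  have hsub : Ω ⊆ {w | ∀ᶠ v in 𝓝 w, g v = 0} := by
    refine hc.subset_of_closure_inter_subset isOpen_setOfPred_eventually_nhds ⟨z, hz, h0⟩ ?_
    rintro w ⟨hw, hwΩ⟩
    obtain ⟨r, hr, hball⟩ := Metric.isOpen_iff.1 hΩ w hwΩ
    obtain ⟨v, hv, hvw⟩ := Metric.mem_closure_iff.1 hw r hr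
    rw [dist_comm] at hvw
    filter_upwards [ball_mem_nhds w hr] with p hp
    set V : Set ℂ := (fun s : ℂ => v + s • (p - v)) ⁻¹' ball w r
    have hcont : Continuous fun s : ℂ => v + s • (p - v) := by fun_prop
    have hVo : IsOpen V := isOpen_ball.preimage hcont
    have hVc : Convex ℝ V := by
      have h1 : Convex ℝ ((fun q => v + q) ⁻¹' ball w r) :=
        (convex_ball w r).translate_preimage_right v
      exact h1.linear_preimage
        ((ContinuousLinearMap.toSpanSingleton ℂ (p - v)).restrictScalars ℝ).toLinearMap
    have han : AnalyticOnNhd ℂ (fun s : ℂ => g (v + s • (p - v))) V :=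
      ((hg v (p - v)).mono fun s hs => hball hs).analyticOnNhd hVo
    have := han.eqOn_zero_of_preconnected_of_eventuallyEq_zero hVc.isPreconnected
      (z₀ := 0) (by simpa [V] using hvw)
      ((hcont.tendsto' 0 v (by simp)).eventually hv) (show (1 : ℂ) ∈ V by simpa [V] using hp)
    simpa using this
  exact fun w hw => (hsub hw).self_of_nhds

/-! ### Operator-valued reproducing kernels. -/

section Kernel

variable {E H H' F : Type*} [NormedAddCommGroup E] [NormedSpace ℂ E]
  [NormedAddCommGroup H] [InnerProductSpace ℂ H] [CompleteSpace H]
  [NormedAddCommGroup H'] [InnerProductSpace ℂ H'] [CompleteSpace H']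
  [NormedAddCommGroup F] [InnerProductSpace ℂ F] [CompleteSpace F]

theorem differentiableOn_adjoint_conj {e : ℂ → H →L[ℂ] F} {ρ : ℝ}
    (he : DifferentiableOn ℂ e (ball 0 ρ)) :
    DifferentiableOn ℂ (fun t => adjoint (e (starRingEnd ℂ t))) (ball 0 ρ) := by
  intro t ht
  have ht' : starRingEnd ℂ t ∈ ball (0 : ℂ) ρ := by simpa using ht
  have h := ((he _ ht').differentiableAt (isOpen_ball.mem_nhds ht')).hasFDerivAt
  let A : (H →L[ℂ] F) →L⋆[ℂ] (F →L[ℂ] H) :=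
    (adjoint (𝕜 := ℂ) (E := H) (F := F)).toContinuousLinearEquiv.toContinuousLinearMap
  exact (HasFDerivAt.comp_semilinear A (starL ℂ : ℂ ≃L⋆[ℂ] ℂ).toContinuousLinearMap
    h).differentiableAt.differentiableWithinAt

/-- The kernel of a holomorphic family of evaluations on a domain is determined by its restriction
to the diagonal. -/
theorem comp_adjoint_eq_of_diagonal {Ω : Set E} (hΩ : IsOpen Ω) (hc : IsPreconnected Ω)
    {e : E → H →L[ℂ] F} {e' : E → H' →L[ℂ] F}
    (he : HolomorphicOnLines e Ω) (he' : HolomorphicOnLines e' Ω)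
    (hdiag : ∀ z ∈ Ω, (e z).comp (adjoint (e z)) = (e' z).comp (adjoint (e' z))) :
    ∀ w ∈ Ω, ∀ z ∈ Ω, (e w).comp (adjoint (e z)) = (e' w).comp (adjoint (e' z)) := by
  intro w hw z hz
  rw [← sub_eq_zero]
  refine HolomorphicOnLines.eqOn_zero hΩ hc
    (g := fun w => (e w).comp (adjoint (e z)) - (e' w).comp (adjoint (e' z)))
    (fun a d => ?_) hz ?_ w hw
  · exact ((he a d).clm_comp (differentiableOn_const _)).sub
      ((he' a d).clm_comp (differentiableOn_const _))
  obtain ⟨r, hr, hball⟩ := Metric.isOpen_iff.1 hΩ z hz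
  filter_upwards [ball_mem_nhds z (show 0 < r / 2 by positivity)] with v hv
  -- On the line through z and v, the parameters 0 and 1 give z and v; radius 2 puts both inside the
  -- disc, and polarization is read off at (1, 0).
  have hmem : ∀ s ∈ ball (0 : ℂ) 2, z + s • (v - z) ∈ Ω := by
    intro s hs
    refine hball ?_
    rw [mem_ball_iff_norm] at hv ⊢
    rw [mem_ball_zero_iff] at hs
    rw [add_sub_cancel_left, norm_smul]
    nlinarith [norm_nonneg (v - z), norm_nonneg s]
  have h1 := (he z (v - z)).mono hmem
  have h2 := (he' z (v - z)).mono hmem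
  have hfst : DifferentiableOn ℂ (Prod.fst : ℂ × ℂ → ℂ) (ball 0 2 ×ˢ ball 0 2) := by fun_prop
  have hsnd : DifferentiableOn ℂ (Prod.snd : ℂ × ℂ → ℂ) (ball 0 2 ×ˢ ball 0 2) := by fun_prop
  have := eq_zero_of_conj_diagonal (ρ := 2)
    (H := fun p => (e (z + p.1 • (v - z))).comp
        (adjoint (e (z + starRingEnd ℂ p.2 • (v - z)))) -
      (e' (z + p.1 • (v - z))).comp (adjoint (e' (z + starRingEnd ℂ p.2 • (v - z)))))
    (((h1.comp hfst fun p hp => hp.1).clm_comp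
        ((differentiableOn_adjoint_conj h1).comp hsnd fun p hp => hp.2)).sub
      ((h2.comp hfst fun p hp => hp.1).clm_comp
        ((differentiableOn_adjoint_conj h2).comp hsnd fun p hp => hp.2)))
    (fun s hs => by simpa [sub_eq_zero] using hdiag _ (hmem s hs)) 1 (by simp) 0 (by simp)
  simpa using this

/-- The orthogonal complement of the ranges of the adjoints is the common kernel of the e i. -/
theorem denseRange_lsum_adjoint {ι : Type*} {e : ι → H →L[ℂ] F} (hsep : ∀ x, (∀ i, e i x = 0) → x = 0) :
    DenseRange (Finsupp.lsum ℂ fun i => (adjoint (e i)).toLinearMap : (ι →₀ F) →ₗ[ℂ] H) := by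
  refine Submodule.dense_iff_topologicalClosure_eq_top (s := LinearMap.range _).2 ?_
  rw [Submodule.topologicalClosure_eq_top_iff, Submodule.eq_bot_iff]
  intro x hx
  refine hsep x fun i => ext_inner_left ℂ fun v => ?_
  have := hx _ ⟨Finsupp.single i v, rfl⟩
  rw [Finsupp.lsum_single] at this
  rw [inner_zero_right, ← adjoint_inner_left]
  exact this

/-- Two point-separating families of evaluations with the same kernel are intertwined by a
unitary. -/
theorem exists_unitary_of_kernel_eq {ι : Type*} {e : ι → H →L[ℂ] F} {e' : ι → H' →L[ℂ] F}
    (hsep : ∀ x, (∀ i, e i x = 0) → x = 0) (hsep' : ∀ x, (∀ i, e' i x = 0) → x = 0)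
    (hker : ∀ i j, (e i).comp (adjoint (e j)) = (e' i).comp (adjoint (e' j))) :
    ∃ U : H ≃ₗᵢ[ℂ] H', ∀ i x, e' i (U x) = e i x := by
  let T : (ι →₀ F) →ₗ[ℂ] H := Finsupp.lsum ℂ fun i => (adjoint (e i)).toLinearMap
  let T' : (ι →₀ F) →ₗ[ℂ] H' := Finsupp.lsum ℂ fun i => (adjoint (e' i)).toLinearMap
  have hT : ∀ c, T c = ∑ i ∈ c.support, adjoint (e i) (c i) := fun c => Finsupp.lsum_apply ..
  have hT' : ∀ c, T' c = ∑ i ∈ c.support, adjoint (e' i) (c i) := fun c => Finsupp.lsum_apply ..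
  have hcomp : ∀ i c, e' i (T' c) = e i (T c) := by
    intro i c
    rw [hT, hT', map_sum, map_sum]
    refine Finset.sum_congr rfl fun j _ => ?_
    exact (DFunLike.congr_fun (hker i j) (c j)).symm
  have hnorm : ∀ c, ‖T' (LinearEquiv.refl ℂ (ι →₀ F) c)‖ = ‖T c‖ := by
    intro c
    rw [LinearEquiv.refl_apply]
    -- Moving the adjoints across leaves only terms ⟪c i, e i (T c)⟫, which the kernel determines.
    have : ⟪T' c, T' c⟫_ℂ = ⟪T c, T c⟫_ℂ := by
      conv_lhs => rw [hT' c, sum_inner]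
      conv_rhs => rw [hT c, sum_inner]
      refine Finset.sum_congr rfl fun i _ => ?_
      rw [adjoint_inner_left, adjoint_inner_left, ← hT, ← hT', hcomp]
    rw [inner_self_eq_norm_sq_to_K, inner_self_eq_norm_sq_to_K] at this
    exact (sq_eq_sq₀ (norm_nonneg _) (norm_nonneg _)).1 (by exact_mod_cast this)
  have hdense : DenseRange T := denseRange_lsum_adjoint hsep
  have hdense' : DenseRange T' := denseRange_lsum_adjoint hsep'
  refine ⟨(LinearEquiv.refl ℂ (ι →₀ F)).extendOfIsometry T T' hdense hdense' hnorm,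
    fun i x => ?_⟩
  refine hdense.induction_on (p := fun x => e' i (((LinearEquiv.refl ℂ (ι →₀ F)).extendOfIsometry
    T T' hdense hdense' hnorm) x) = e i x) x (isClosed_eq ?_ ?_) fun c => ?_
  · exact (e' i).continuous.comp (LinearIsometryEquiv.continuous _)
  · exact (e i).continuous
  · rw [LinearEquiv.extendOfIsometry_eq]
    exact hcomp i c

/-- A section of `e` with values in `(ker e)ᗮ` inverts `e` there. -/
theorem section_apply_of_mem_ker_orthogonal {K G : Type*} [NormedAddCommGroup K]
    [InnerProductSpace ℂ K] [NormedAddCommGroup G] [NormedSpace ℂ G] {e : K →L[ℂ] G}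
    {L : G →L[ℂ] K} (hL : e.comp L = .id ℂ G) (hr : ∀ v, L v ∈ e.kerᗮ) {x : K} (hx : x ∈ e.kerᗮ) :
    L (e x) = x := by
  have hmem : L (e x) - x ∈ e.ker := by
    have := DFunLike.congr_fun hL (e x)
    simp only [comp_apply, id_apply] at this
    simp [this]
  exact sub_eq_zero.1 (inner_self_eq_zero (𝕜 := ℂ).1 ((e.kerᗮ.sub_mem (hr _) hx) _ hmem))

/-- The range of e† lies in (ker e)ᗮ, where L e is the identity, so L†L e e† = L†e† = (e L)† = 1. -/
theorem gram_comp_comp_adjoint {e : H →L[ℂ] F} {L : F →L[ℂ] H}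
    (hL : e.comp L = .id ℂ F) (hr : ∀ v, L v ∈ e.kerᗮ) :
    ((adjoint L).comp L).comp (e.comp (adjoint e)) = .id ℂ F := by
  ext v
  have hv : adjoint e v ∈ e.kerᗮ := fun x hx => by
    rw [adjoint_inner_right, show e x = 0 from hx, inner_zero_left]
  have h := section_apply_of_mem_ker_orthogonal hL hr hv
  simp only [comp_apply, id_apply, h]
  refine ext_inner_left ℂ fun w => ?_
  rw [adjoint_inner_right, adjoint_inner_right]
  exact congrArg (⟪·, v⟫_ℂ) (DFunLike.congr_fun hL w)

/-- Both factors are self-adjoint, so taking adjoints makes the one-sided inverse two-sided. -/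
theorem comp_adjoint_comp_gram {e : H →L[ℂ] F} {L : F →L[ℂ] H}
    (hL : e.comp L = .id ℂ F) (hr : ∀ v, L v ∈ e.kerᗮ) :
    (e.comp (adjoint e)).comp ((adjoint L).comp L) = .id ℂ F := by
  have := congrArg adjoint (gram_comp_comp_adjoint hL hr)
  simpa [adjoint_comp, adjoint_id] using this

/-- The Gram operator of a section of `e` with values in `(ker e)ᗮ` determines `e e†`. -/
theorem comp_adjoint_eq_of_gram {e : H →L[ℂ] F} {e' : H' →L[ℂ] F} {L : F →L[ℂ] H} {L' : F →L[ℂ] H'}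
    (hL : e.comp L = .id ℂ F) (hL' : e'.comp L' = .id ℂ F)
    (hr : ∀ v, L v ∈ e.kerᗮ) (hr' : ∀ v, L' v ∈ e'.kerᗮ)
    (hgram : (adjoint L).comp L = (adjoint L').comp L') :
    e.comp (adjoint e) = e'.comp (adjoint e') :=
  left_inv_eq_right_inv (M := F →L[ℂ] F) (comp_adjoint_comp_gram hL hr)
    (hgram ▸ gram_comp_comp_adjoint hL' hr')

end Kernel

/-! ### Bounded evaluations on a quasi-free module. -/

section Evaluation

variable {n m : ℕ} {Ω : Set (EuclideanSpace ℂ (Fin n))}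
  {R : Type*} [NormedAddCommGroup R] [InnerProductSpace ℂ R]
  [Module (FunctionAlgebra Ω) R] [IsScalarTower ℂ (FunctionAlgebra Ω) R]

/-- `combination f` as a linear map. -/
def combinationLinear (f : Fin m → R) : (Fin m → FunctionAlgebra Ω) →ₗ[ℂ] R where
  toFun := combination f
  map_add' φ ψ := by simp [combination, add_smul, Finset.sum_add_distrib]
  map_smul' c φ := by simp [combination, Finset.smul_sum]

open Classical in
/-- `evalAt` as a linear map, extended by zero to the points outside `Ω`. -/
def evalLinear (x : EuclideanSpace ℂ (Fin n)) :
    (Fin m → FunctionAlgebra Ω) →ₗ[ℂ] EuclideanSpace ℂ (Fin m) where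
  toFun φ := if h : x ∈ Ω then evalAt ⟨x, h⟩ φ else 0
  map_add' φ ψ := by
    split_ifs
    · ext i; simp [evalAt, value]
    · simp
  map_smul' c φ := by
    split_ifs
    · ext i; simp [evalAt, value]
    · simp

theorem evalLinear_apply (z : Ω) (φ : Fin m → FunctionAlgebra Ω) :
    evalLinear (z : EuclideanSpace ℂ (Fin n)) φ = evalAt z φ :=
  dif_pos z.2

/-- The evaluation at `x` on the Hilbert module `R`. -/
def evaluation (f : Fin m → R) (x : EuclideanSpace ℂ (Fin n)) : R →L[ℂ] EuclideanSpace ℂ (Fin m) :=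
  (evalLinear (Ω := Ω) x).extendOfNorm (combinationLinear f)

variable {f : Fin m → R}

namespace IsQuasiFree

theorem denseRange (hf : IsQuasiFree Ω f) :
    DenseRange (combinationLinear (Ω := Ω) f) := by
  refine hf.generates.mono fun x hx => ?_
  obtain ⟨c, hc⟩ := (Submodule.mem_span_range_iff_exists_fun _).1 hx
  exact ⟨c, hc⟩

theorem exists_bound (hf : IsQuasiFree Ω f) (x : EuclideanSpace ℂ (Fin n)) :
    ∃ C, ∀ φ, ‖evalLinear (Ω := Ω) x φ‖ ≤ C * ‖combinationLinear f φ‖ := by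
  by_cases hx : x ∈ Ω
  · obtain ⟨C, hC⟩ := hf.eval_locally_bounded ⟨x, hx⟩
    exact ⟨C, fun φ => by simpa using evalLinear_apply ⟨x, hx⟩ φ ▸ hC.self_of_nhds φ⟩
  · exact ⟨0, fun φ => by simp [evalLinear, hx]⟩

theorem evaluation_combination (hf : IsQuasiFree Ω f) (z : Ω) (φ : Fin m → FunctionAlgebra Ω) :
    evaluation (Ω := Ω) f z (combination f φ) = evalAt z φ :=
  (LinearMap.extendOfNorm_eq hf.denseRange (hf.exists_bound z) φ).trans (evalLinear_apply z φ)

theorem evaluation_generator (hf : IsQuasiFree Ω f) (z : Ω) (i : Fin m) :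
    evaluation (Ω := Ω) f z (f i) = EuclideanSpace.single i 1 := by
  have h : combination f (Pi.single i (1 : FunctionAlgebra Ω)) = f i := by
    simp [combination, Pi.single_apply, ite_smul]
  conv_lhs => rw [← h, hf.evaluation_combination]
  ext j
  by_cases hj : j = i
  · subst hj; simp [evalAt, value]
  · simp [evalAt, value, hj]

theorem evaluation_smul [IsBoundedSMul (FunctionAlgebra Ω) R] (hf : IsQuasiFree Ω f) (z : Ω) (φ : FunctionAlgebra Ω) (h : R) :
    evaluation (Ω := Ω) f z (φ • h) = value φ z • evaluation (Ω := Ω) f z h := by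
  refine hf.denseRange.induction_on (p := fun h => evaluation (Ω := Ω) f z (φ • h) =
    value φ z • evaluation (Ω := Ω) f z h) h (isClosed_eq (by fun_prop) (by fun_prop)) fun ψ => ?_
  have h1 : φ • combination f ψ = combination f (fun i => φ * ψ i) := by
    simp only [combination, Finset.smul_sum, mul_smul]
  change evaluation (Ω := Ω) f z (φ • combination f ψ) =
    value φ z • evaluation (Ω := Ω) f z (combination f ψ)
  rw [h1, hf.evaluation_combination, hf.evaluation_combination]
  ext i
  simp [evalAt, value]

/-- Condition (iv) enters here: tuples approximating h have evaluations tending to zero, hence tend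
to zero in norm. -/
theorem eq_zero_of_evaluation (hf : IsQuasiFree Ω f) {h : R}
    (h0 : ∀ z : Ω, evaluation (Ω := Ω) f z h = 0) : h = 0 := by
  obtain ⟨u, hu, hlim⟩ := mem_closure_iff_seq_limit.1 (hf.denseRange h)
  choose F hF using hu
  have hlim' : Tendsto (fun k => combination f (F k)) atTop (𝓝 h) := by
    have hu : (fun k => combination f (F k)) = u := funext hF
    rwa [hu]
  refine tendsto_nhds_unique hlim' ((hf.tendsto_zero_iff F hlim'.cauchySeq).1 fun z => ?_)
  have := ((evaluation (Ω := Ω) f z).continuous.tendsto h).comp hlim'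
  rw [h0 z] at this
  exact this.congr fun k => hf.evaluation_combination z (F k)

/-- Multiplicativity of evaluation gives R_z ≤ ker. Conversely, modulo R_z any h is ∑ c_i f_i, whose
evaluation is the vector c; if h is in the kernel then c = 0. -/
theorem ker_evaluation [IsBoundedSMul (FunctionAlgebra Ω) R] (hf : IsQuasiFree Ω f) (z : Ω) :
    (evaluation (Ω := Ω) f z).ker = vanishingSubmodule R z := by
  have hle : vanishingSubmodule R z ≤ (evaluation (Ω := Ω) f z).ker := by
    refine Submodule.topologicalClosure_minimal _ (Submodule.span_le.2 ?_)
      (evaluation (Ω := Ω) f z).isClosed_ker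
    rintro x ⟨φ, h, hφ, rfl⟩
    have := hf.evaluation_smul z φ h
    rw [hφ, zero_smul] at this
    exact this
  refine le_antisymm (fun h hh => ?_) hle
  have hspan : localize h z ∈ Submodule.span ℂ (range fun i => localize (f i) z) := by
    rw [hf.span_eq_top z]; trivial
  obtain ⟨c, hc⟩ := (Submodule.mem_span_range_iff_exists_fun _).1 hspan
  have hsub : h - ∑ i, c i • f i ∈ vanishingSubmodule R z := by
    rw [← Submodule.Quotient.eq]
    refine hc.symm.trans ?_
    simp only [localize, ← Submodule.mkQ_apply, map_sum, map_smul]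
  have h0 := hle hsub
  have hc0 : ∀ i, c i = 0 := by
    have h1 : evaluation (Ω := Ω) f z h = 0 := hh
    have h2 : evaluation (Ω := Ω) f z (h - ∑ i, c i • f i) = 0 := h0
    simp only [map_sub, h1, map_sum, map_smul, hf.evaluation_generator, zero_sub,
      neg_eq_zero] at h2
    intro i
    simpa [Finset.sum_apply, Pi.single_apply] using congrArg (fun v => v i) h2
  simpa [hc0] using hsub

theorem eventually_norm_evaluation_le (hf : IsQuasiFree Ω f) (hΩ : IsOpen Ω)
    {x : EuclideanSpace ℂ (Fin n)} (hx : x ∈ Ω) :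
    ∃ C, ∀ᶠ w in 𝓝 x, ‖evaluation (Ω := Ω) f w‖ ≤ C := by
  obtain ⟨C, hC⟩ := hf.eval_locally_bounded ⟨x, hx⟩
  rw [nhds_subtype_eq_comap, eventually_comap] at hC
  -- The operator norm bound needs a nonnegative constant, which (iii) does not provide.
  refine ⟨max C 0, ?_⟩
  filter_upwards [hC, hΩ.mem_nhds hx] with w hw hwΩ
  refine LinearMap.opNorm_extendOfNorm_le hf.denseRange (le_max_right _ _) fun φ => ?_
  refine (evalLinear_apply ⟨w, hwΩ⟩ φ ▸ hw ⟨w, hwΩ⟩ rfl φ).trans ?_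
  exact mul_le_mul_of_nonneg_right (le_max_left _ _) (norm_nonneg _)

end IsQuasiFree

open Classical in
/-- The functions in `A(Ω)` are holomorphic along complex lines. -/
theorem holomorphicOnLines_value (hΩ : IsOpen Ω) (φ : FunctionAlgebra Ω) :
    HolomorphicOnLines (fun x => if h : x ∈ Ω then value φ ⟨x, h⟩ else 0) Ω := by
  intro a d
  have hV : IsOpen {s : ℂ | a + s • d ∈ Ω} := hΩ.preimage (by fun_prop)
  obtain ⟨u, hu, hlim⟩ := mem_closure_iff_seq_limit.1 φ.2
  choose U g hUo hUΩ hg hug using hu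
  have hmem : ∀ {s : ℂ}, s ∈ {s : ℂ | a + s • d ∈ Ω} → a + s • d ∈ Ω := fun h => h
  refine TendstoLocallyUniformlyOn.differentiableOn (F := fun k s => g k (a + s • d))
    (φ := atTop) ?_ (Eventually.of_forall fun k => ?_) hV
  · refine TendstoUniformlyOn.tendstoLocallyUniformlyOn ?_
    rw [Metric.tendstoUniformlyOn_iff]
    intro ε hε
    filter_upwards [Metric.tendsto_nhds.1 hlim ε hε] with k hk s hs
    rw [dif_pos (hmem hs), dist_comm]
    have := hug k ⟨a + s • d, subset_closure (hmem hs)⟩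
    rw [← this]
    exact (BoundedContinuousFunction.dist_coe_le_dist _).trans_lt hk
  · exact (hg k).comp (f := fun s : ℂ => a + s • d) (by fun_prop)
      fun s hs => hUΩ k (subset_closure hs)

/-- For fixed h, the evaluations are locally uniform limits of those of tuples from A(Ω); the local
bound in (iii) supplies the uniformity and the passage to norm holomorphy. -/
theorem IsQuasiFree.holomorphicOnLines_evaluation (hf : IsQuasiFree Ω f) (hΩ : IsOpen Ω) :
    HolomorphicOnLines (evaluation (Ω := Ω) f) Ω := by
  classical
  intro a d
  have hcont : Continuous fun s : ℂ => a + s • d := by fun_prop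
  have hV : IsOpen {s : ℂ | a + s • d ∈ Ω} := hΩ.preimage hcont
  have hmem : ∀ {s : ℂ}, s ∈ {s : ℂ | a + s • d ∈ Ω} → a + s • d ∈ Ω := fun h => h
  have hb : ∀ s ∈ {s : ℂ | a + s • d ∈ Ω},
      ∃ C, ∀ᶠ t in 𝓝 s, ‖evaluation (Ω := Ω) f (a + t • d)‖ ≤ C := by
    intro s hs
    obtain ⟨C, hC⟩ := hf.eventually_norm_evaluation_le hΩ (hmem hs)
    exact ⟨C, hcont.continuousAt.eventually hC⟩
  refine differentiableOn_of_forall_apply hV (fun h => ?_) hb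
  obtain ⟨u, hu, hlim⟩ := mem_closure_iff_seq_limit.1 (hf.denseRange h)
  refine TendstoLocallyUniformlyOn.differentiableOn
    (F := fun k s => evaluation (Ω := Ω) f (a + s • d) (u k)) (φ := atTop) ?_
    (Eventually.of_forall fun k => ?_) hV
  · rw [Metric.tendstoLocallyUniformlyOn_iff]
    intro ε hε s hs
    obtain ⟨C, hC⟩ := hb s hs
    refine ⟨_, mem_nhdsWithin_of_mem_nhds hC, ?_⟩
    have hC0 : 0 ≤ C := (norm_nonneg _).trans hC.self_of_nhds
    filter_upwards [Metric.tendsto_nhds.1 hlim (ε / (C + 1)) (by positivity)] with k hk t ht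
    rw [dist_comm, dist_eq_norm, ← map_sub]
    rw [dist_eq_norm, lt_div_iff₀ (by positivity)] at hk
    refine (le_of_opNorm_le _ ht _).trans_lt ?_
    nlinarith [norm_nonneg (u k - h)]
  · obtain ⟨φ, hφ⟩ := hu k
    rw [differentiableOn_euclidean]
    intro i
    refine (holomorphicOnLines_value hΩ (φ i) a d).congr fun s hs => ?_
    have := hf.evaluation_combination ⟨a + s • d, hs⟩ φ
    rw [← hφ]
    refine (congrArg (fun v => v i) this).trans ?_
    beta_reduce
    rw [dif_pos (hmem hs)]
    rfl

end Evaluation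

/-! ### Localized Gram matrices, the unitary and its graph. -/

section Equivalence

variable {n m : ℕ} {Ω : Set (EuclideanSpace ℂ (Fin n))}
  {R : Type*} [NormedAddCommGroup R] [InnerProductSpace ℂ R]
  [Module (FunctionAlgebra Ω) R]
  {R' : Type*} [NormedAddCommGroup R'] [InnerProductSpace ℂ R']
  [Module (FunctionAlgebra Ω) R']

/-- One inclusion holds because the graph of U is closed, the other because Δ is closed and U is
determined on the dense span of the f i. -/
theorem deltaGraph_eq_graph (f : Fin m → R) (f' : Fin m → R') (U : R →L[ℂ] R')
    (hU : ∀ (φ : FunctionAlgebra Ω) h, U (φ • h) = φ • U h) (hUf : ∀ i, U (f i) = f' i)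
    (hf : Dense (Submodule.span (FunctionAlgebra Ω) (range f) : Set R)) :
    deltaGraph Ω f f' = U.toLinearMap.graph := by
  refine le_antisymm (Submodule.topologicalClosure_minimal _ (Submodule.span_le.2 ?_)
    (isClosed_eq continuous_snd (U.continuous.comp continuous_fst))) ?_
  · rintro _ ⟨φ, i, rfl⟩
    simp [LinearMap.mem_graph_iff, hU, hUf]
  · rintro ⟨h, k⟩ hk
    obtain rfl : k = U h := hk
    have hcl : IsClosed {h | (h, U h) ∈ deltaGraph Ω f f'} :=
      (Submodule.isClosed_topologicalClosure _).preimage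
        (continuous_id.prodMk U.continuous)
    refine hcl.closure_subset_iff.2 (fun x hx => ?_) (hf h)
    obtain ⟨c, rfl⟩ := (Submodule.mem_span_range_iff_exists_fun _).1 hx
    have : (∑ i, c i • f i, U (∑ i, c i • f i)) = ∑ i, (c i • f i, c i • f' i) := by
      simp [map_sum, hU, hUf, Prod.ext_iff, Prod.fst_sum, Prod.snd_sum]
    change (∑ i, c i • f i, U (∑ i, c i • f i)) ∈ deltaGraph Ω f f'
    rw [this]
    exact Submodule.sum_mem _ fun i _ =>
      Submodule.le_topologicalClosure _ (Submodule.subset_span ⟨c i, i, rfl⟩)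

variable [CompleteSpace R] [CompleteSpace R']

/-- The representative of the localized vector `h ⊗ 1_z` orthogonal to `R_z`. -/
def localizedRepr (h : R) (z : Ω) : R :=
  ((vanishingSubmodule R z).quotientEquivOrthogonal (localize h z) : (vanishingSubmodule R z)ᗮ)

theorem localizedRepr_mem (h : R) (z : Ω) : localizedRepr h z ∈ (vanishingSubmodule R z)ᗮ :=
  Subtype.property _

theorem localizedRepr_sub_mem (h : R) (z : Ω) : localizedRepr h z - h ∈ vanishingSubmodule R z := by
  refine (Submodule.Quotient.eq (vanishingSubmodule R z)).1 ?_
  refine ((vanishingSubmodule R z).quotientEquivOrthogonal_symm_eq_mk _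
    (localizedRepr_mem h z)).symm.trans ?_
  exact LinearIsometryEquiv.symm_apply_apply _ (localize h z)

/-- The quotient inner product is by definition that of the orthogonal representatives. -/
theorem inner_localizedRepr (h k : R) (z : Ω) :
    ⟪localizedRepr h z, localizedRepr k z⟫_ℂ = ⟪localize h z, localize k z⟫_ℂ := rfl

/-- The map `ℓ²_m → R` sending the basis to the representatives of the localized generators. -/
def localizedFrame (f : Fin m → R) (z : Ω) : EuclideanSpace ℂ (Fin m) →L[ℂ] R :=
  ∑ i, (EuclideanSpace.proj i : EuclideanSpace ℂ (Fin m) →L[ℂ] ℂ).smulRight (localizedRepr (f i) z)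

theorem localizedFrame_apply (f : Fin m → R) (z : Ω) (v : EuclideanSpace ℂ (Fin m)) :
    localizedFrame f z v = ∑ i, v i • localizedRepr (f i) z := by
  simp [localizedFrame, sum_apply]

theorem adjoint_localizedFrame_comp {f : Fin m → R} {f' : Fin m → R'} {z : Ω}
    (hGram : ∀ i j, ⟪localize (f i) z, localize (f j) z⟫_ℂ =
      ⟪localize (f' i) z, localize (f' j) z⟫_ℂ) :
    (adjoint (localizedFrame f z)).comp (localizedFrame f z) =
      (adjoint (localizedFrame f' z)).comp (localizedFrame f' z) := by
  refine ContinuousLinearMap.ext fun v => ext_inner_left ℂ fun w => ?_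
  rw [comp_apply, comp_apply, adjoint_inner_right, adjoint_inner_right]
  simp only [localizedFrame_apply, sum_inner, inner_sum, inner_smul_left, inner_smul_right,
    inner_localizedRepr, hGram]

variable [IsScalarTower ℂ (FunctionAlgebra Ω) R] [IsBoundedSMul (FunctionAlgebra Ω) R]
  [IsScalarTower ℂ (FunctionAlgebra Ω) R'] [IsBoundedSMul (FunctionAlgebra Ω) R']
  {f : Fin m → R} {f' : Fin m → R'}

namespace IsQuasiFree

theorem localizedFrame_mem (hf : IsQuasiFree Ω f) (z : Ω) (v : EuclideanSpace ℂ (Fin m)) :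
    localizedFrame f z v ∈ (evaluation (Ω := Ω) f z).kerᗮ := by
  rw [hf.ker_evaluation, localizedFrame_apply]
  exact Submodule.sum_mem _ fun i _ => Submodule.smul_mem _ _ (localizedRepr_mem _ _)

/-- Each representative differs from f_i by an element of R_z = ker e_z, so it too evaluates to the
i-th basis vector. -/
theorem evaluation_comp_localizedFrame (hf : IsQuasiFree Ω f) (z : Ω) :
    (evaluation (Ω := Ω) f z).comp (localizedFrame f z) = .id ℂ _ := by
  have h : ∀ i, evaluation (Ω := Ω) f z (localizedRepr (f i) z) = EuclideanSpace.single i 1 := by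
    intro i
    have := localizedRepr_sub_mem (f i) z
    rw [← hf.ker_evaluation] at this
    rw [← hf.evaluation_generator z i, ← sub_eq_zero, ← map_sub]
    exact this
  refine ContinuousLinearMap.ext fun v => ?_
  rw [comp_apply, localizedFrame_apply, map_sum, id_apply]
  ext j
  simp [h, Pi.single_apply]

theorem exists_unitary (hf : IsQuasiFree Ω f) (hf' : IsQuasiFree Ω f')
    (hΩ : IsOpen Ω) (hc : IsPreconnected Ω)
    (hGram : ∀ (z : Ω) (i j : Fin m), ⟪localize (f i) z, localize (f j) z⟫_ℂ =
      ⟪localize (f' i) z, localize (f' j) z⟫_ℂ) :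
    ∃ U : R ≃ₗᵢ[ℂ] R', (∀ (φ : FunctionAlgebra Ω) (h : R), U (φ • h) = φ • U h) ∧
      ∀ i, U (f i) = f' i := by
  have hker := comp_adjoint_eq_of_diagonal hΩ hc (hf.holomorphicOnLines_evaluation hΩ)
    (hf'.holomorphicOnLines_evaluation hΩ) fun z hz =>
      comp_adjoint_eq_of_gram (hf.evaluation_comp_localizedFrame ⟨z, hz⟩)
        (hf'.evaluation_comp_localizedFrame ⟨z, hz⟩) (hf.localizedFrame_mem ⟨z, hz⟩)
        (hf'.localizedFrame_mem ⟨z, hz⟩) (adjoint_localizedFrame_comp (hGram ⟨z, hz⟩))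
  obtain ⟨U, hU⟩ := exists_unitary_of_kernel_eq
    (e := fun z : Ω => evaluation (Ω := Ω) f z) (e' := fun z : Ω => evaluation (Ω := Ω) f' z)
    (fun _ => hf.eq_zero_of_evaluation) (fun _ => hf'.eq_zero_of_evaluation)
    fun w z => hker w w.2 z z.2
  refine ⟨U, fun φ h => ?_, fun i => ?_⟩
  -- Both sides have evaluation φ(z) e_z(h) at every z, and evaluations separate points.
  · refine sub_eq_zero.1 (hf'.eq_zero_of_evaluation fun z => ?_)
    rw [map_sub, hf'.evaluation_smul, hU, hU, hf.evaluation_smul, sub_self]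
  · refine sub_eq_zero.1 (hf'.eq_zero_of_evaluation fun z => ?_)
    rw [map_sub, hU, hf.evaluation_generator, hf'.evaluation_generator, sub_self]

end IsQuasiFree

end Equivalence

end QuasiFree

end

theorem theorem3 {n m : ℕ} (Ω : Set (EuclideanSpace ℂ (Fin n)))
    (hΩ_open : IsOpen Ω) (hΩ_conn : IsConnected Ω) (hΩ_bdd : Bornology.IsBounded Ω)
    {R : Type*} [NormedAddCommGroup R] [InnerProductSpace ℂ R] [CompleteSpace R]
    [Module (QuasiFree.FunctionAlgebra Ω) R] [IsScalarTower ℂ (QuasiFree.FunctionAlgebra Ω) R]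
    [IsBoundedSMul (QuasiFree.FunctionAlgebra Ω) R]
    {R' : Type*} [NormedAddCommGroup R'] [InnerProductSpace ℂ R'] [CompleteSpace R']
    [Module (QuasiFree.FunctionAlgebra Ω) R'] [IsScalarTower ℂ (QuasiFree.FunctionAlgebra Ω) R']
    [IsBoundedSMul (QuasiFree.FunctionAlgebra Ω) R']
    (f : Fin m → R) (f' : Fin m → R')
    (hf : QuasiFree.IsQuasiFree Ω f) (hf' : QuasiFree.IsQuasiFree Ω f')
    (hGram : ∀ (z : Ω) (i j : Fin m),
      ⟪QuasiFree.localize (f i) z, QuasiFree.localize (f j) z⟫_ℂ =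
        ⟪QuasiFree.localize (f' i) z, QuasiFree.localize (f' j) z⟫_ℂ) :
    (QuasiFree.delta Ω f f').graph = QuasiFree.deltaGraph Ω f f' ∧
      QuasiFree.IsIsometricModuleMap Ω (QuasiFree.delta Ω f f') ∧
      QuasiFree.UnitarilyEquivalent Ω R R' := by
  obtain ⟨U, hU, hUf⟩ := hf.exists_unitary hf' hΩ_open hΩ_conn.isPreconnected hGram
  have hgraph := QuasiFree.deltaGraph_eq_graph f f' (U : R →L[ℂ] R') hU hUf hf.generates
  have hmem : ∀ p : R × R', p ∈ QuasiFree.deltaGraph Ω f f' ↔ p.2 = U p.1 := by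
    intro p
    rw [hgraph]
    exact LinearMap.mem_graph_iff _ _
  -- Single-valuedness of Δ, without which `toLinearPMap` need not have graph Δ.
  have hfun : ∀ p ∈ QuasiFree.deltaGraph Ω f f', p.1 = 0 → p.2 = 0 := by
    intro p hp h0
    rw [(hmem p).1 hp, h0, map_zero]
  have hdom : (QuasiFree.delta Ω f f').domain = ⊤ :=
    eq_top_iff.2 fun x _ => ⟨(x, U x), (hmem _).2 rfl, rfl⟩
  have happ : ∀ x : (QuasiFree.delta Ω f f').domain, QuasiFree.delta Ω f f' x = U x := fun x =>
    (hmem _).1 (Submodule.mem_graph_toLinearPMap hfun x)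
  refine ⟨Submodule.toLinearPMap_graph_eq _ hfun, ⟨hdom, fun x => ?_, fun φ x => ?_⟩, U, hU⟩
  · rw [happ, LinearIsometryEquiv.norm_map]
  · refine ⟨hdom.ge Submodule.mem_top, ?_⟩
    rw [happ, happ, hU]
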